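/- Let $n\ge 1$ and let $S_n$ be the group of permutations of $\{1,\dots,n\}$, regarded as a Coxeter group with generators the adjacent transpositions $s_i=(i\ \,i+1)$, $1\le i\le n-1$. Let $\ell$ be its length function and $\le$ its Bruhat order: $v\le w$ if and only if some reduced expression of $w$ has a (not necessarily consecutive) subword that is a reduced expression of $v$. For $w\in S_n$ let $$h_w(q)=\sum_{v\le w}q^{\ell(v)}$$ be the Poincaré polynomial of the lower Bruhat interval of $w$. Let $\mathrm{Sm}_n$ be the set of smooth permutations, that is, of those $w\in S_n$ that avoid the patterns $3412$ and $4231$, and let $U_n$ be the set of unimodal permutations, that is, of those $w\in S_n$ for which there is $i\in\{0,\dots,n\}$ such that $w(j)<w(j+1)$ for all $1\le j<i$ and $w(j)>w(j+1)$ for all $i<j<n$. Then $$\{h_w(q): w\in \mathrm{Sm}_n\}=\{h_w(q): w\in U_n\}.$$ In particular, $|\{h_w(q): w\in \mathrm{Sm}_n\}|=2^{n-1}$. -/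

import Mathlib

open Polynomial

namespace SmoothBruhat

section Coxeter

variable {W : Type*} [Group W]

/-- `a` is an expression (word) of `w` in the generators `S`. -/
def IsWordOf (S : Set W) (a : List W) (w : W) : Prop :=
  (∀ s ∈ a, s ∈ S) ∧ a.prod = w

/-- The length of `w` with respect to a generating set `S` of involutions: the smallest length of
an expression of `w` in the generators. -/
noncomputable def length (S : Set W) (w : W) : ℕ :=
  sInf {k | ∃ a : List W, IsWordOf S a w ∧ a.length = k}

/-- `a` is a reduced expression of `w`. -/
def IsReducedWordOf (S : Set W) (a : List W) (w : W) : Prop :=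
  IsWordOf S a w ∧ a.length = length S w

/-- The Bruhat order, by the subword property: `v ≤ w` if and only if some reduced expression of
`w` has a subword (of not necessarily consecutive letters) that is a reduced expression of `v`. -/
def BruhatLE (S : Set W) (v w : W) : Prop :=
  ∃ a b : List W, IsReducedWordOf S a w ∧ b.Sublist a ∧ IsReducedWordOf S b v

open Classical in
/-- The Poincaré polynomial `h_w(q) = ∑_{v ≤ w} q ^ ℓ(v)` of the lower Bruhat interval of `w`. -/
noncomputable def poincare [Fintype W] (S : Set W) (w : W) : ℤ[X] :=
  ∑ v : W with BruhatLE S v w, X ^ length S v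

end Coxeter

/-- The standard Coxeter generators of the symmetric group: the transpositions of two adjacent
elements. -/
def simpleTranspositions (n : ℕ) : Set (Equiv.Perm (Fin n)) :=
  {s | ∃ (i : ℕ) (h : i + 1 < n), s = Equiv.swap ⟨i, Nat.lt_of_succ_lt h⟩ ⟨i + 1, h⟩}

/-- `h_w(q)` for `w ∈ S_n`. -/
noncomputable def h {n : ℕ} (w : Equiv.Perm (Fin n)) : ℤ[X] :=
  poincare (simpleTranspositions n) w

/-- `σ` avoids the pattern `τ`: there are no positions `i_1 < ⋯ < i_k` with
`σ(i_{τ⁻¹(1)}) < ⋯ < σ(i_{τ⁻¹(k)})`. -/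
def Avoids {n k : ℕ} (σ : Equiv.Perm (Fin n)) (τ : Equiv.Perm (Fin k)) : Prop :=
  ¬ ∃ i : Fin k → Fin n, StrictMono i ∧ StrictMono fun j => σ (i (τ⁻¹ j))

/-- The permutation `3412`, written with the values `0, 1, 2, 3`. -/
def perm3412 : Equiv.Perm (Fin 4) where
  toFun := ![2, 3, 0, 1]
  invFun := ![2, 3, 0, 1]
  left_inv := by decide
  right_inv := by decide

/-- The permutation `4231`, written with the values `0, 1, 2, 3`. -/
def perm4231 : Equiv.Perm (Fin 4) where
  toFun := ![3, 1, 2, 0]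
  invFun := ![3, 1, 2, 0]
  left_inv := by decide
  right_inv := by decide

/-- The smooth permutations in `S_n`. -/
def smooth (n : ℕ) : Set (Equiv.Perm (Fin n)) :=
  {w | Avoids w perm3412 ∧ Avoids w perm4231}

/-- The unimodal permutations in `S_n`: there is `i ∈ {0, …, n}` such that, in one-line notation
with positions `1, …, n`, `w(j) < w(j+1)` for all `j < i` and `w(j) > w(j+1)` for all `i < j < n`.
Here the position `j` is the element `j - 1` of `Fin n`. -/
def unimodal (n : ℕ) : Set (Equiv.Perm (Fin n)) :=
  {w | ∃ i ≤ n, ∀ (j : ℕ) (hj : j + 1 < n),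
    (j + 1 < i → w ⟨j, Nat.lt_of_succ_lt hj⟩ < w ⟨j + 1, hj⟩) ∧
    (i < j + 1 → w ⟨j + 1, hj⟩ < w ⟨j, Nat.lt_of_succ_lt hj⟩)}

end SmoothBruhat

/-!
Write `v ⊑ w` when every initial segment of the one-line notation of `v` has at least as many values
below `j` as that of `w`, for all `j`. The length of a permutation is its number of inversions, and
the Bruhat order is `⊑` (`bruhatLE_iff_rankLE`), so `h w` is the sum of `q ^ numInv v` over `v ⊑ w`.

Suppose that `w` decreases from the position `d` of its largest value on, and let `w'` be `w` with
that value removed. Then the permutations `v ⊑ w` are exactly those obtained from some `v' ⊑ w'` by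
inserting the largest value in a position `p ≥ d` (`rankLE_ins_iff`), and this insertion adds `n - p`
inversions, where positions run from `0` to `n`. Hence `h w` is `[n - d + 1]_q` times `h w'`
(`h_ins`).

If `w` is smooth, then `w` or its inverse has this property (`strictAntiOn_or_of_mem_smooth`), and
`h` takes the same value on both. So `h w` is a product of `q`-integers `[e + 1]_q`, one for each
letter. The exponents `e` form a down-closed multiset: if the last `k + 1` values of `w` or of its
inverse decrease, then `k` is an exponent, and when the largest value is removed from `w` as above,
`n - d` values from position `d` on still decrease; so `n - d - 1` is an exponent of `w'`
(`exists_hasExponents`).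

Listing the exponents increasingly, each one is equal to the previous one or larger by one, which
gives a list of booleans (`exists_codePoly_eq`). Conversely each such list comes from a unimodal
permutation, built by inserting the largest value next to the previous largest one
(`exists_unimodal_h_eq`). Unimodal permutations have no valleys, so they are smooth. Finally the
list can be recovered from the polynomial: the largest exponent is seen from the roots of unity at
which the polynomial vanishes, and the corresponding factor can be cancelled (`codePoly_injOn`).
-/

namespace SmoothBruhat

/-! ### Inversions and the length function -/

/-- The adjacent transposition exchanging `i` and `i + 1`. -/
abbrev adj {n : ℕ} (i : ℕ) (hi : i + 1 < n) : Equiv.Perm (Fin n) :=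
  Equiv.swap ⟨i, Nat.lt_of_succ_lt hi⟩ ⟨i + 1, hi⟩

lemma adj_mem {n : ℕ} (i : ℕ) (hi : i + 1 < n) : adj i hi ∈ simpleTranspositions n :=
  ⟨i, hi, rfl⟩

/-- The number of inversions of a permutation. -/
def numInv {n : ℕ} (w : Equiv.Perm (Fin n)) : ℕ :=
  ∑ a, ∑ b, if a < b ∧ w b < w a then 1 else 0

lemma numInv_one {n : ℕ} : numInv (1 : Equiv.Perm (Fin n)) = 0 := by
  simp only [numInv, Equiv.Perm.one_apply]
  refine Finset.sum_eq_zero fun a _ => Finset.sum_eq_zero fun b _ => if_neg ?_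
  exact fun hab => lt_asymm hab.1 hab.2

lemma numInv_inv {n : ℕ} (w : Equiv.Perm (Fin n)) : numInv w⁻¹ = numInv w := by
  unfold numInv
  rw [← Equiv.sum_comp w, Finset.sum_comm, ← Equiv.sum_comp w]
  simp [and_comm]

lemma numInv_mul_adj {n : ℕ} (w : Equiv.Perm (Fin n)) (i : ℕ) (hi : i + 1 < n) :
    numInv (w * adj i hi) + (if w ⟨i + 1, hi⟩ < w ⟨i, Nat.lt_of_succ_lt hi⟩ then 1 else 0) =
      numInv w + (if w ⟨i, Nat.lt_of_succ_lt hi⟩ < w ⟨i + 1, hi⟩ then 1 else 0) := by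
  set p : Fin n := ⟨i, Nat.lt_of_succ_lt hi⟩ with hp
  set q : Fin n := ⟨i + 1, hi⟩ with hq
  have hadj : adj i hi = Equiv.swap p q := rfl
  have key : ∀ a b : Fin n,
      (if Equiv.swap p q a < Equiv.swap p q b ∧ w b < w a then 1 else 0) +
        (if a = p then if b = q then if w q < w p then 1 else 0 else 0 else 0) =
      (if a < b ∧ w b < w a then 1 else 0) +
        (if a = q then if b = p then if w p < w q then 1 else 0 else 0 else 0) := by
    intro a b
    have hpq : p < q := by simp [hp, hq]
    by_cases h1 : a = p <;> by_cases h2 : a = q <;> by_cases h3 : b = p <;> by_cases h4 : b = q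
    all_goals simp_all [Equiv.swap_apply_def]
    all_goals
      congr 2
      simp only [Fin.lt_def, Fin.ext_iff, eq_iff_iff] at *
      omega
  have e1 : numInv (w * adj i hi) =
      ∑ a, ∑ b, if Equiv.swap p q a < Equiv.swap p q b ∧ w b < w a then 1 else 0 := by
    unfold numInv
    rw [hadj, ← Equiv.sum_comp (Equiv.swap p q)]
    refine Finset.sum_congr rfl fun a _ => ?_
    rw [← Equiv.sum_comp (Equiv.swap p q)]
    simp
  have e2 := Finset.sum_congr rfl fun (a : Fin n) (_ : a ∈ Finset.univ) =>
    Finset.sum_congr rfl fun (b : Fin n) (_ : b ∈ Finset.univ) => key a b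
  simp only [Finset.sum_add_distrib] at e2
  rw [← e1] at e2
  simpa [numInv] using e2

lemma numInv_mul_adj_of_lt {n : ℕ} {w : Equiv.Perm (Fin n)} {i : ℕ} {hi : i + 1 < n}
    (hlt : w ⟨i, Nat.lt_of_succ_lt hi⟩ < w ⟨i + 1, hi⟩) : numInv (w * adj i hi) = numInv w + 1 := by
  have := numInv_mul_adj w i hi
  rwa [if_neg hlt.not_gt, if_pos hlt] at this

lemma numInv_mul_adj_of_gt {n : ℕ} {w : Equiv.Perm (Fin n)} {i : ℕ} {hi : i + 1 < n}
    (hlt : w ⟨i + 1, hi⟩ < w ⟨i, Nat.lt_of_succ_lt hi⟩) : numInv (w * adj i hi) + 1 = numInv w := by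
  have := numInv_mul_adj w i hi
  rwa [if_neg hlt.not_gt, if_pos hlt] at this

lemma lt_or_gt_adj {n : ℕ} (w : Equiv.Perm (Fin n)) (i : ℕ) (hi : i + 1 < n) :
    w ⟨i, Nat.lt_of_succ_lt hi⟩ < w ⟨i + 1, hi⟩ ∨ w ⟨i + 1, hi⟩ < w ⟨i, Nat.lt_of_succ_lt hi⟩ := by
  refine lt_or_gt_of_ne fun e => ?_
  have := w.injective e
  simp at this

lemma eq_one_of_le {n : ℕ} {w : Equiv.Perm (Fin n)} (hw : ∀ a, w a ≤ a) : w = 1 := by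
  have hsum : ∑ a, (w a : ℕ) = ∑ a : Fin n, (a : ℕ) :=
    Equiv.sum_comp w (fun a : Fin n => (a : ℕ))
  have := (Finset.sum_eq_sum_iff_of_le (fun a _ => Fin.le_def.1 (hw a))).1 hsum
  ext a
  simpa using this a (Finset.mem_univ a)

lemma exists_descent_of_ne_one {n : ℕ} {w : Equiv.Perm (Fin n)} (hw : w ≠ 1) :
    ∃ (i : ℕ) (hi : i + 1 < n), w ⟨i + 1, hi⟩ < w ⟨i, Nat.lt_of_succ_lt hi⟩ := by
  by_contra! hno
  apply hw
  rw [← inv_eq_one]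
  refine eq_one_of_le fun b => ?_
  have hle : ∀ (a : ℕ) (ha : a < n), a ≤ (w ⟨a, ha⟩ : ℕ) := by
    intro a
    induction a with
    | zero => intro ha; exact Nat.zero_le _
    | succ a ih =>
      intro ha
      have h1 := ih (by omega)
      have h2 := (lt_or_gt_adj w a ha).resolve_right (hno a ha).not_gt
      rw [Fin.lt_def] at h2
      omega
  have := hle (w⁻¹ b) (w⁻¹ b).2
  rw [Fin.le_def]
  simpa using this

lemma numInv_prod_le {n : ℕ} (a : List (Equiv.Perm (Fin n)))
    (ha : ∀ s ∈ a, s ∈ simpleTranspositions n) : numInv a.prod ≤ a.length := by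
  induction a using List.reverseRecOn with
  | nil => simp [numInv_one]
  | append_singleton a s ih =>
    obtain ⟨i, hi, rfl⟩ := ha s (by simp)
    have h1 := ih fun s hs => ha s (by simp [hs])
    rw [List.prod_append, List.prod_singleton, List.length_append, List.length_singleton]
    change numInv (a.prod * adj i hi) ≤ _
    rcases lt_or_gt_adj a.prod i hi with hlt | hlt
    · rw [numInv_mul_adj_of_lt hlt]; omega
    · have := numInv_mul_adj_of_gt hlt; omega

lemma exists_word {n : ℕ} (w : Equiv.Perm (Fin n)) :
    ∃ a, IsWordOf (simpleTranspositions n) a w ∧ a.length = numInv w := by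
  induction hk : numInv w generalizing w with
  | zero =>
    have : w = 1 := by
      by_contra hw
      obtain ⟨i, hi, hd⟩ := exists_descent_of_ne_one hw
      have := numInv_mul_adj_of_gt hd
      omega
    exact ⟨[], by simp [IsWordOf, this], rfl⟩
  | succ k ih =>
    have : w ≠ 1 := by rintro rfl; simp [numInv_one] at hk
    obtain ⟨i, hi, hd⟩ := exists_descent_of_ne_one this
    have h1 := numInv_mul_adj_of_gt hd
    obtain ⟨a, ⟨ha, hprod⟩, hl⟩ := ih (w * adj i hi) (by omega)
    refine ⟨a ++ [adj i hi], ⟨?_, ?_⟩, by simp [hl]⟩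
    · intro s hs
      rcases List.mem_append.1 hs with hs | hs
      · exact ha s hs
      · rw [List.mem_singleton.1 hs]; exact adj_mem i hi
    · simp [hprod, mul_assoc]

lemma length_eq_numInv {n : ℕ} (w : Equiv.Perm (Fin n)) :
    length (simpleTranspositions n) w = numInv w := by
  obtain ⟨a, ha, hl⟩ := exists_word w
  refine le_antisymm (Nat.sInf_le ⟨a, ha, hl⟩) (le_csInf ⟨_, a, ha, rfl⟩ ?_)
  rintro k ⟨b, ⟨hb, rfl⟩, rfl⟩
  exact numInv_prod_le b hb

lemma isReducedWordOf_iff {n : ℕ} {a : List (Equiv.Perm (Fin n))} {w : Equiv.Perm (Fin n)} :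
    IsReducedWordOf (simpleTranspositions n) a w ↔
      (∀ s ∈ a, s ∈ simpleTranspositions n) ∧ a.prod = w ∧ a.length = numInv w := by
  rw [IsReducedWordOf, IsWordOf, length_eq_numInv, and_assoc]

lemma IsReducedWordOf.append_adj {n : ℕ} {a : List (Equiv.Perm (Fin n))} {w : Equiv.Perm (Fin n)}
    {i : ℕ} {hi : i + 1 < n} (hd : w ⟨i + 1, hi⟩ < w ⟨i, Nat.lt_of_succ_lt hi⟩)
    (ha : IsReducedWordOf (simpleTranspositions n) a (w * adj i hi)) :
    IsReducedWordOf (simpleTranspositions n) (a ++ [adj i hi]) w := by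
  rw [isReducedWordOf_iff] at ha ⊢
  obtain ⟨h1, h2, h3⟩ := ha
  refine ⟨?_, by simp [h2, mul_assoc], ?_⟩
  · intro s hs
    rcases List.mem_append.1 hs with hs | hs
    · exact h1 s hs
    · rw [List.mem_singleton.1 hs]; exact adj_mem i hi
  · have := numInv_mul_adj_of_gt hd
    simp only [List.length_append, List.length_singleton]
    omega

lemma IsReducedWordOf.of_append_adj {n : ℕ} {a : List (Equiv.Perm (Fin n))}
    {w : Equiv.Perm (Fin n)} {i : ℕ} {hi : i + 1 < n}
    (ha : IsReducedWordOf (simpleTranspositions n) (a ++ [adj i hi]) w) :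
    ∃ w' : Equiv.Perm (Fin n), IsReducedWordOf (simpleTranspositions n) a w' ∧
      w = w' * adj i hi ∧ w' ⟨i, Nat.lt_of_succ_lt hi⟩ < w' ⟨i + 1, hi⟩ := by
  rw [isReducedWordOf_iff] at ha
  obtain ⟨h1, h2, h3⟩ := ha
  have hmem : ∀ s ∈ a, s ∈ simpleTranspositions n := fun s hs => h1 s (by simp [hs])
  have hle := numInv_prod_le a hmem
  rw [List.prod_append, List.prod_singleton] at h2
  simp only [List.length_append, List.length_singleton] at h3
  rcases lt_or_gt_adj a.prod i hi with hlt | hlt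
  · have := numInv_mul_adj_of_lt hlt
    rw [h2] at this
    exact ⟨a.prod, isReducedWordOf_iff.2 ⟨hmem, rfl, by omega⟩, h2.symm, hlt⟩
  · have := numInv_mul_adj_of_gt hlt
    rw [h2] at this
    omega

/-! ### The rank description of the Bruhat order -/

/-- The rank function of a permutation: the number of positions `a < i` whose value is less
than `j`. -/
def rk {n : ℕ} (w : Equiv.Perm (Fin n)) (i j : ℕ) : ℕ :=
  ∑ a : Fin n, if (a : ℕ) < i ∧ (w a : ℕ) < j then 1 else 0

/-- Comparison of rank functions. It is reversed because longer permutations have fewer small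
values in their initial segments. -/
def RankLE {n : ℕ} (v w : Equiv.Perm (Fin n)) : Prop :=
  ∀ i j, rk w i j ≤ rk v i j

lemma RankLE.refl {n : ℕ} (w : Equiv.Perm (Fin n)) : RankLE w w := fun _ _ => le_rfl

lemma rk_inv {n : ℕ} (w : Equiv.Perm (Fin n)) (i j : ℕ) : rk w⁻¹ i j = rk w j i := by
  unfold rk
  rw [← Equiv.sum_comp w]
  simp [and_comm]

lemma rankLE_inv {n : ℕ} {v w : Equiv.Perm (Fin n)} : RankLE v⁻¹ w⁻¹ ↔ RankLE v w := by
  unfold RankLE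
  simp only [rk_inv]
  exact forall_comm

lemma rk_succ {n : ℕ} (w : Equiv.Perm (Fin n)) {i : ℕ} (hi : i < n) (j : ℕ) :
    rk w (i + 1) j = rk w i j + if (w ⟨i, hi⟩ : ℕ) < j then 1 else 0 := by
  have key : ∀ a : Fin n, (if (a : ℕ) < i + 1 ∧ (w a : ℕ) < j then 1 else 0) =
      (if (a : ℕ) < i ∧ (w a : ℕ) < j then 1 else 0) +
        (if a = ⟨i, hi⟩ then if (w a : ℕ) < j then 1 else 0 else 0) := by
    intro a
    simp only [Fin.ext_iff]
    split_ifs <;> omega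
  unfold rk
  simp only [key, Finset.sum_add_distrib]
  simp

lemma rk_mul_adj_of_ne {n : ℕ} (w : Equiv.Perm (Fin n)) {i : ℕ} (hi : i + 1 < n) {k : ℕ}
    (hk : k ≠ i + 1) (j : ℕ) : rk (w * adj i hi) k j = rk w k j := by
  unfold rk
  rw [← Equiv.sum_comp (adj i hi)]
  refine Finset.sum_congr rfl fun a _ => ?_
  have : ((adj i hi a : Fin n) : ℕ) < k ↔ (a : ℕ) < k := by
    simp only [adj, Equiv.swap_apply_def, Fin.ext_iff]
    split_ifs <;> simp <;> omega
  simp [this]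

lemma rk_mul_adj {n : ℕ} (w : Equiv.Perm (Fin n)) {i : ℕ} (hi : i + 1 < n) (j : ℕ) :
    rk (w * adj i hi) (i + 1) j = rk w i j + if (w ⟨i + 1, hi⟩ : ℕ) < j then 1 else 0 := by
  rw [rk_succ _ (Nat.lt_of_succ_lt hi), rk_mul_adj_of_ne _ _ (by omega)]
  simp

/-- One half of the lifting property: if `v` ascends at `i`, then `v` stays below `w` when the values
of `w` in positions `i` and `i + 1` are exchanged, even if this makes `w` shorter. The other half
is contained in `RankLE.mul_adj`. -/
lemma RankLE.lower_right {n : ℕ} {v w : Equiv.Perm (Fin n)} (hvw : RankLE v w) {i : ℕ}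
    {hi : i + 1 < n} (hv : v ⟨i, Nat.lt_of_succ_lt hi⟩ < v ⟨i + 1, hi⟩) :
    RankLE v (w * adj i hi) := by
  intro k j
  by_cases hk : k = i + 1
  · subst hk
    have h1 := hvw i j
    have h3 := hvw (i + 2) j
    rw [rk_succ _ hi, rk_succ _ hi, rk_succ _ (Nat.lt_of_succ_lt hi),
      rk_succ _ (Nat.lt_of_succ_lt hi)] at h3
    rw [rk_mul_adj, rk_succ _ (Nat.lt_of_succ_lt hi)]
    rw [Fin.lt_def] at hv
    split_ifs at * <;> omega
  · rw [rk_mul_adj_of_ne _ _ hk]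
    exact hvw k j

lemma RankLE.raise_right {n : ℕ} {v w : Equiv.Perm (Fin n)} (hvw : RankLE v w) {i : ℕ}
    {hi : i + 1 < n} (hw : w ⟨i, Nat.lt_of_succ_lt hi⟩ < w ⟨i + 1, hi⟩) :
    RankLE v (w * adj i hi) := by
  intro k j
  by_cases hk : k = i + 1
  · subst hk
    have h2 := hvw (i + 1) j
    rw [rk_succ _ (Nat.lt_of_succ_lt hi)] at h2
    rw [rk_mul_adj]
    rw [Fin.lt_def] at hw
    split_ifs at * <;> omega
  · rw [rk_mul_adj_of_ne _ _ hk]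
    exact hvw k j

lemma RankLE.mul_adj {n : ℕ} {v w : Equiv.Perm (Fin n)} (hvw : RankLE v w) {i : ℕ}
    {hi : i + 1 < n}
    (hor : (w ⟨i, Nat.lt_of_succ_lt hi⟩ < w ⟨i + 1, hi⟩) ∨
      v ⟨i + 1, hi⟩ < v ⟨i, Nat.lt_of_succ_lt hi⟩) :
    RankLE (v * adj i hi) (w * adj i hi) := by
  intro k j
  by_cases hk : k = i + 1
  · subst hk
    have h1 := hvw i j
    have h3 := hvw (i + 2) j
    have h2 := hvw (i + 1) j
    rw [rk_succ _ hi, rk_succ _ hi, rk_succ _ (Nat.lt_of_succ_lt hi),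
      rk_succ _ (Nat.lt_of_succ_lt hi)] at h3
    rw [rk_succ _ (Nat.lt_of_succ_lt hi), rk_succ _ (Nat.lt_of_succ_lt hi)] at h2
    rw [rk_mul_adj, rk_mul_adj]
    rw [Fin.lt_def, Fin.lt_def] at hor
    split_ifs at * <;> omega
  · rw [rk_mul_adj_of_ne _ _ hk, rk_mul_adj_of_ne _ _ hk]
    exact hvw k j

lemma rk_one_self {n : ℕ} {i : ℕ} (hi : i ≤ n) : rk (1 : Equiv.Perm (Fin n)) i i = i := by
  induction i with
  | zero => simp [rk]
  | succ i ih =>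
    have hext : rk (1 : Equiv.Perm (Fin n)) i (i + 1) = rk (1 : Equiv.Perm (Fin n)) i i := by
      unfold rk
      refine Finset.sum_congr rfl fun a _ => ?_
      refine if_congr ?_ rfl rfl
      rw [Equiv.Perm.one_apply]
      omega
    rw [rk_succ _ hi, hext, ih (by omega)]
    simp

lemma eq_one_of_rankLE_one {n : ℕ} {v : Equiv.Perm (Fin n)} (hv : RankLE v 1) : v = 1 := by
  refine eq_one_of_le fun a => ?_
  by_contra! hlt
  have h1 := hv (a + 1) (a + 1)
  rw [rk_one_self a.2, rk_succ _ a.2, if_neg (by simpa using hlt)] at h1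
  have h2 : ∀ i ≤ n, rk v i (a + 1) ≤ i := by
    intro i
    induction i with
    | zero => intro _; simp [rk]
    | succ i ih =>
      intro hi
      rw [rk_succ _ hi]
      have := ih (by omega)
      split_ifs <;> omega
  have := h2 a a.2.le
  omega

/-- Both directions are by induction on the length of the larger permutation, multiplying it on
the right by an adjacent transposition. -/
theorem bruhatLE_iff_rankLE {n : ℕ} {v w : Equiv.Perm (Fin n)} :
    BruhatLE (simpleTranspositions n) v w ↔ RankLE v w := by
  constructor
  · rintro ⟨a, b, ha, hab, hb⟩
    induction a using List.reverseRecOn generalizing b v w with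
    | nil =>
      rw [List.sublist_nil] at hab
      subst hab
      rw [isReducedWordOf_iff] at ha hb
      rw [← ha.2.1, ← hb.2.1]
      exact RankLE.refl 1
    | append_singleton a s ih =>
      obtain ⟨i, hi, rfl⟩ := (isReducedWordOf_iff.1 ha).1 s (by simp)
      obtain ⟨w', hw', rfl, hlt⟩ := ha.of_append_adj
      obtain ⟨b₁, b₂, rfl, hb₁, hb₂⟩ := List.sublist_append_iff.1 hab
      rcases List.sublist_singleton.1 hb₂ with rfl | rfl
      · rw [List.append_nil] at hb
        exact (ih b₁ hw' hb₁ hb).raise_right hlt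
      · obtain ⟨v', hv', rfl, -⟩ := hb.of_append_adj
        exact (ih b₁ hw' hb₁ hv').mul_adj (Or.inl hlt)
  · intro hvw
    induction hk : numInv w using Nat.strong_induction_on generalizing v w with
    | _ k ih =>
      by_cases hw : w = 1
      · subst hw
        rw [eq_one_of_rankLE_one hvw]
        obtain ⟨a, ha, hl⟩ := exists_word (1 : Equiv.Perm (Fin n))
        have : IsReducedWordOf (simpleTranspositions n) a 1 := ⟨ha, by rw [hl, length_eq_numInv]⟩
        exact ⟨a, a, this, List.Sublist.refl a, this⟩
      · obtain ⟨i, hi, hd⟩ := exists_descent_of_ne_one hw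
        have hinv := numInv_mul_adj_of_gt hd
        rcases lt_or_gt_adj v i hi with hv | hv
        · obtain ⟨a, b, ha, hab, hb⟩ := ih _ (by omega) (hvw.lower_right hv) rfl
          exact ⟨a ++ [adj i hi], b, ha.append_adj hd,
            hab.trans (List.sublist_append_left a _), hb⟩
        · obtain ⟨a, b, ha, hab, hb⟩ := ih _ (by omega) (hvw.mul_adj (Or.inr hv)) rfl
          exact ⟨a ++ [adj i hi], b ++ [adj i hi], ha.append_adj hd,
            hab.append (List.Sublist.refl _), hb.append_adj hv⟩

open Classical in
lemma h_eq {n : ℕ} (w : Equiv.Perm (Fin n)) :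
    h w = ∑ v : Equiv.Perm (Fin n), if RankLE v w then (X : ℤ[X]) ^ numInv v else 0 := by
  simp only [h, poincare, Finset.sum_filter, bruhatLE_iff_rankLE, length_eq_numInv]

lemma h_inv {n : ℕ} (w : Equiv.Perm (Fin n)) : h w⁻¹ = h w := by
  classical
  rw [h_eq, h_eq, ← Equiv.sum_comp (Equiv.inv _)]
  simp [rankLE_inv, numInv_inv]

/-! ### Inserting the largest value -/

/-- The permutation whose one-line notation arises from that of `v` by inserting a new largest
value in position `p`. -/
def ins {n : ℕ} (p : Fin (n + 1)) (v : Equiv.Perm (Fin n)) : Equiv.Perm (Fin (n + 1)) :=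
  (finSuccEquiv' p).trans ((Equiv.optionCongr v).trans (finSuccEquiv' (Fin.last n)).symm)

@[simp] lemma ins_self {n : ℕ} (p : Fin (n + 1)) (v : Equiv.Perm (Fin n)) :
    ins p v p = Fin.last n := by
  simp [ins]

@[simp] lemma ins_succAbove {n : ℕ} (p : Fin (n + 1)) (v : Equiv.Perm (Fin n)) (a : Fin n) :
    ins p v (p.succAbove a) = (v a).castSucc := by
  simp [ins]

lemma ins_bijective (n : ℕ) :
    Function.Bijective fun x : Fin (n + 1) × Equiv.Perm (Fin n) => ins x.1 x.2 := by
  rw [Fintype.bijective_iff_injective_and_card]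
  constructor
  · rintro ⟨p, v⟩ ⟨q, w⟩ (heq : ins p v = ins q w)
    obtain rfl : p = q := by
      apply (ins q w).injective
      rw [ins_self, ← heq, ins_self]
    have : v = w := by
      ext a
      have := congrArg (fun u => u (p.succAbove a)) heq
      simp only [ins_succAbove, Fin.castSucc_inj] at this
      rw [this]
    rw [this]
  · simp [Fintype.card_perm, Nat.factorial_succ]

lemma exists_eq_ins {n : ℕ} (w : Equiv.Perm (Fin (n + 1))) : ∃ p v, w = ins p v := by
  obtain ⟨⟨p, v⟩, hpv⟩ := (ins_bijective n).2 w
  exact ⟨p, v, hpv.symm⟩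

lemma card_le_castSucc {n : ℕ} (p : Fin (n + 1)) :
    (∑ b : Fin n, if p ≤ b.castSucc then 1 else 0) = n - (p : ℕ) := by
  have e : (∑ b : Fin n, if p ≤ b.castSucc then 1 else 0) =
      ∑ b : Fin n, (fun k : ℕ => if (p : ℕ) ≤ k then 1 else 0) b := rfl
  rw [e, Fin.sum_univ_eq_sum_range (fun k : ℕ => if (p : ℕ) ≤ k then 1 else 0) n, Finset.sum_boole,
    show (Finset.range n).filter (fun k => (p : ℕ) ≤ k) = Finset.Ico (p : ℕ) n by
      ext; simp; omega]
  simp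

lemma numInv_ins {n : ℕ} (p : Fin (n + 1)) (v : Equiv.Perm (Fin n)) :
    numInv (ins p v) = numInv v + (n - p) := by
  unfold numInv
  rw [Fin.sum_univ_succAbove _ p, Fin.sum_univ_succAbove _ p]
  simp only [Fin.sum_univ_succAbove _ p, ins_self, ins_succAbove]
  simp [Fin.lt_succAbove_iff_le_castSucc, Fin.castSucc_lt_last, Fin.succAbove_lt_succAbove_iff,
    (Fin.castSucc_lt_last _).not_gt, card_le_castSucc, -Finset.sum_boole, add_comm]

lemma rk_ins_of_le {n : ℕ} {p : Fin (n + 1)} (v : Equiv.Perm (Fin n)) {i : ℕ} (hi : i ≤ p)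
    (j : ℕ) : rk (ins p v) i j = rk v i j := by
  unfold rk
  rw [Fin.sum_univ_succAbove _ p, ins_self, if_neg (by simp; omega), zero_add]
  refine Finset.sum_congr rfl fun a _ => if_congr ?_ rfl rfl
  rw [ins_succAbove, Fin.val_castSucc]
  refine and_congr_left fun _ => ?_
  unfold Fin.succAbove
  split_ifs with hlt
  · simp
  · rw [Fin.lt_def, Fin.val_castSucc] at hlt
    rw [Fin.val_succ]
    omega

lemma rk_ins_succ_of_le {n : ℕ} {p : Fin (n + 1)} (v : Equiv.Perm (Fin n)) {i j : ℕ} (hi : p ≤ i)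
    (hj : j ≤ n) : rk (ins p v) (i + 1) j = rk v i j := by
  unfold rk
  rw [Fin.sum_univ_succAbove _ p, ins_self, if_neg (by simp; omega), zero_add]
  refine Finset.sum_congr rfl fun a _ => if_congr ?_ rfl rfl
  rw [ins_succAbove, Fin.val_castSucc]
  refine and_congr_left fun _ => ?_
  unfold Fin.succAbove
  split_ifs with hlt
  · rw [Fin.lt_def, Fin.val_castSucc] at hlt
    rw [Fin.val_castSucc]
    omega
  · rw [Fin.val_succ]
    omega

lemma rk_of_le {n : ℕ} (v w : Equiv.Perm (Fin n)) (i : ℕ) {j : ℕ} (hj : n ≤ j) :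
    rk v i j = rk w i j := by
  unfold rk
  refine Finset.sum_congr rfl fun a _ => if_congr ?_ rfl rfl
  have := (v a).2
  have := (w a).2
  omega

lemma rk_mono {n : ℕ} (v : Equiv.Perm (Fin n)) {i i' : ℕ} (hi : i ≤ i') (j : ℕ) :
    rk v i j ≤ rk v i' j := by
  unfold rk
  refine Finset.sum_le_sum fun a _ => ?_
  split_ifs <;> omega

lemma rk_full {n : ℕ} (v w : Equiv.Perm (Fin n)) (j : ℕ) : rk v n j = rk w n j := by
  have key : ∀ u : Equiv.Perm (Fin n), rk u n j = ∑ a : Fin n, if (a : ℕ) < j then 1 else 0 := by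
    intro u
    unfold rk
    rw [← Equiv.sum_comp u fun a : Fin n => if (a : ℕ) < j then 1 else 0]
    simp
  rw [key, key]

lemma rk_full_le {n : ℕ} (v : Equiv.Perm (Fin n)) {i : ℕ} (hi : i ≤ n) (j : ℕ) :
    rk v n j ≤ rk v i j + (n - i) := by
  induction hk : n - i generalizing i with
  | zero => rw [show i = n by omega]; rfl
  | succ k ih =>
    have h1 := ih (i := i + 1) (by omega) (by omega)
    rw [rk_succ v (by omega : i < n)] at h1
    split_ifs at h1 <;> omega

lemma rk_full_eq {n : ℕ} (v : Equiv.Perm (Fin n)) {i : ℕ} (hi : i ≤ n) {j : ℕ}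
    (hv : ∀ a : Fin n, i ≤ a → (v a : ℕ) < j) : rk v n j = rk v i j + (n - i) := by
  induction hk : n - i generalizing i with
  | zero => rw [show i = n by omega]; rfl
  | succ k ih =>
    have h1 := ih (i := i + 1) (by omega) (fun a ha => hv a (by omega)) (by omega)
    rw [rk_succ v (by omega : i < n), if_pos (hv _ le_rfl)] at h1
    omega

lemma succAbove_of_le {n : ℕ} {p : Fin (n + 1)} {a : Fin n} (ha : (p : ℕ) ≤ a) :
    p.succAbove a = a.succ :=
  Fin.succAbove_of_le_castSucc _ _ ha

lemma strictAntiOn_of_ins {n : ℕ} {d : Fin (n + 1)} {w : Equiv.Perm (Fin n)}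
    (hw : StrictAntiOn (ins d w) (Set.Ici d)) {a b : Fin n} (ha : (d : ℕ) ≤ a) (hab : a < b) :
    w b < w a := by
  have hb : (d : ℕ) ≤ b := ha.trans hab.le
  have := hw (a := a.succ) (b := b.succ) (Fin.le_def.2 (by simp; omega))
    (Fin.le_def.2 (by simp; omega)) (Fin.succ_lt_succ_iff.2 hab)
  rw [← succAbove_of_le ha, ← succAbove_of_le hb, ins_succAbove, ins_succAbove] at this
  exact Fin.castSucc_lt_castSucc_iff.1 this

/-- If a permutation decreases from the position of its largest value on, then its lower Bruhat
interval is obtained from that of the permutation with the largest value removed by inserting the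
largest value in all positions that are not to the left of the original one. -/
theorem rankLE_ins_iff {n : ℕ} {d : Fin (n + 1)} {w : Equiv.Perm (Fin n)}
    (hw : StrictAntiOn (ins d w) (Set.Ici d)) (p : Fin (n + 1)) (v : Equiv.Perm (Fin n)) :
    RankLE (ins p v) (ins d w) ↔ d ≤ p ∧ RankLE v w := by
  have hp := p.2
  have hd := d.2
  constructor
  · intro hvw
    have hdp : d ≤ p := by
      by_contra! hlt
      rw [Fin.lt_def] at hlt
      have h1 := hvw (p + 1) n
      have h2 := rk_of_le (n := n) v w p le_rfl
      rw [rk_ins_succ_of_le v le_rfl le_rfl, rk_ins_of_le w hlt,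
        rk_succ w (show (p : ℕ) < n by omega), if_pos (w _).2] at h1
      omega
    refine ⟨hdp, fun i j => ?_⟩
    rw [Fin.le_def] at hdp
    rcases le_total n j with hj | hj
    · exact (rk_of_le w v i hj).le
    rcases le_or_gt i d with hid | hid
    · have := hvw i j
      rwa [rk_ins_of_le v (hid.trans hdp), rk_ins_of_le w hid] at this
    rcases le_or_gt (p : ℕ) i with hpi | hpi
    · have := hvw (i + 1) j
      rwa [rk_ins_succ_of_le v hpi hj, rk_ins_succ_of_le w hid.le hj] at this
    -- Between the two positions, row `i` of the rank function of `v` is compared with the previous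
    -- row of that of `w`; the two rows of `w` agree unless all later values of `w` are below `j`.
    obtain ⟨i, rfl⟩ : ∃ k, i = k + 1 := ⟨i - 1, by omega⟩
    have hin : i < n := by omega
    by_cases hj' : (w ⟨i, hin⟩ : ℕ) < j
    · have h1 := rk_full_eq w (i := i + 1) hin (j := j) fun a ha =>
        lt_trans (strictAntiOn_of_ins hw (a := ⟨i, hin⟩) (by simp; omega)
          (Fin.lt_def.2 (by simp; omega))) hj'
      have h2 := rk_full_le v (i := i + 1) hin j
      have h3 := rk_full v w j
      omega
    · have := hvw (i + 1) j
      rw [rk_ins_of_le v hpi.le, rk_ins_succ_of_le w (by omega) hj] at this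
      rwa [rk_succ w hin, if_neg hj', add_zero]
  · rintro ⟨hdp, hvw⟩ i j
    rw [Fin.le_def] at hdp
    rcases le_or_gt j n with hj | hj
    · rcases le_or_gt i d with hid | hid
      · rw [rk_ins_of_le v (hid.trans hdp), rk_ins_of_le w hid]
        exact hvw i j
      · obtain ⟨i, rfl⟩ : ∃ k, i = k + 1 := ⟨i - 1, by omega⟩
        rw [rk_ins_succ_of_le w (by omega) hj]
        rcases le_or_gt (i + 1) p with hip | hip
        · rw [rk_ins_of_le v hip]
          exact (hvw i j).trans (rk_mono v (Nat.le_succ i) j)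
        · rw [rk_ins_succ_of_le v (by omega) hj]
          exact hvw i j
    · exact (rk_of_le _ _ i hj).le

/-- The `q`-analogue `1 + q + ⋯ + q ^ m` of `m + 1`. -/
noncomputable def qInt (m : ℕ) : ℤ[X] :=
  ∑ k ∈ Finset.range (m + 1), X ^ k

lemma sum_ite_le_eq_qInt {n : ℕ} (d : Fin (n + 1)) :
    (∑ p : Fin (n + 1), if d ≤ p then (X : ℤ[X]) ^ (n - (p : ℕ)) else 0) = qInt (n - d) := by
  rw [← Equiv.sum_comp Fin.revPerm]
  have hd := d.2
  have e : ∀ p : Fin (n + 1), (if d ≤ Fin.revPerm p then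
      (X : ℤ[X]) ^ (n - ((Fin.revPerm p : Fin (n + 1)) : ℕ)) else 0) =
      (fun k : ℕ => if k < n - d + 1 then (X : ℤ[X]) ^ k else 0) p := by
    intro p
    have hp := p.2
    simp only [Fin.revPerm_apply, Fin.le_def, Fin.val_rev]
    rw [show n - (n + 1 - (p + 1)) = (p : ℕ) by omega]
    exact if_congr (by omega) rfl rfl
  rw [Finset.sum_congr rfl fun p _ => e p,
    Fin.sum_univ_eq_sum_range (fun k : ℕ => if k < n - d + 1 then (X : ℤ[X]) ^ k else 0),
    ← Finset.sum_filter, qInt]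
  congr 1
  ext k
  simp
  omega

theorem h_ins {n : ℕ} {d : Fin (n + 1)} {w : Equiv.Perm (Fin n)}
    (hw : StrictAntiOn (ins d w) (Set.Ici d)) : h (ins d w) = qInt (n - d) * h w := by
  classical
  rw [h_eq, h_eq, ← sum_ite_le_eq_qInt, Finset.sum_mul_sum,
    ← Equiv.sum_comp (Equiv.ofBijective _ (ins_bijective n)), Fintype.sum_prod_type]
  refine Finset.sum_congr rfl fun p _ => Finset.sum_congr rfl fun v _ => ?_
  simp only [Equiv.ofBijective_apply, rankLE_ins_iff hw, numInv_ins]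
  by_cases h1 : d ≤ p <;> by_cases h2 : RankLE v w <;> simp [h1, h2, pow_add, mul_comm]

/-! ### Smooth permutations -/

lemma avoids_perm3412_iff {n : ℕ} {σ : Equiv.Perm (Fin n)} :
    Avoids σ perm3412 ↔ ∀ a b c d, a < b → b < c → c < d → σ c < σ d → σ d < σ a → ¬ σ a < σ b := by
  constructor
  · intro hσ a b c d hab hbc hcd h1 h2 h3
    refine hσ ⟨![a, b, c, d], ?_, ?_⟩
    · rw [Fin.strictMono_iff_lt_succ]
      simp [Fin.forall_fin_succ, hab, hbc, hcd]
    · rw [Fin.strictMono_iff_lt_succ]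
      intro i
      fin_cases i
      exacts [h1, h2, h3]
  · rintro hσ ⟨i, hi, hs⟩
    exact hσ (i 0) (i 1) (i 2) (i 3) (hi (by decide)) (hi (by decide)) (hi (by decide))
      (hs (a := 0) (b := 1) (by decide)) (hs (a := 1) (b := 2) (by decide))
      (hs (a := 2) (b := 3) (by decide))

lemma avoids_perm4231_iff {n : ℕ} {σ : Equiv.Perm (Fin n)} :
    Avoids σ perm4231 ↔ ∀ a b c d, a < b → b < c → c < d → σ d < σ b → σ b < σ c → ¬ σ c < σ a := by
  constructor
  · intro hσ a b c d hab hbc hcd h1 h2 h3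
    refine hσ ⟨![a, b, c, d], ?_, ?_⟩
    · rw [Fin.strictMono_iff_lt_succ]
      simp [Fin.forall_fin_succ, hab, hbc, hcd]
    · rw [Fin.strictMono_iff_lt_succ]
      intro i
      fin_cases i
      exacts [h1, h2, h3]
  · rintro hσ ⟨i, hi, hs⟩
    exact hσ (i 0) (i 1) (i 2) (i 3) (hi (by decide)) (hi (by decide)) (hi (by decide))
      (hs (a := 0) (b := 1) (by decide)) (hs (a := 1) (b := 2) (by decide))
      (hs (a := 2) (b := 3) (by decide))

lemma mem_smooth_iff {n : ℕ} {w : Equiv.Perm (Fin n)} : w ∈ smooth n ↔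
    (∀ a b c d, a < b → b < c → c < d → w c < w d → w d < w a → ¬ w a < w b) ∧
    ∀ a b c d, a < b → b < c → c < d → w d < w b → w b < w c → ¬ w c < w a := by
  rw [← avoids_perm3412_iff, ← avoids_perm4231_iff]
  rfl

lemma inv_mem_smooth {n : ℕ} {w : Equiv.Perm (Fin n)} (hw : w ∈ smooth n) : w⁻¹ ∈ smooth n := by
  rw [mem_smooth_iff] at hw ⊢
  refine ⟨fun a b c d hab hbc hcd h1 h2 h3 => ?_, fun a b c d hab hbc hcd h1 h2 h3 => ?_⟩
  · exact hw.1 (w⁻¹ c) (w⁻¹ d) (w⁻¹ a) (w⁻¹ b) h1 h2 h3 (by simpa using hab) (by simpa using hbc)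
      (by simpa using hcd)
  · exact hw.2 (w⁻¹ d) (w⁻¹ b) (w⁻¹ c) (w⁻¹ a) h1 h2 h3 (by simpa using hab) (by simpa using hbc)
      (by simpa using hcd)

lemma mem_smooth_of_ins {n : ℕ} {p : Fin (n + 1)} {w : Equiv.Perm (Fin n)}
    (hw : ins p w ∈ smooth (n + 1)) : w ∈ smooth n := by
  rw [mem_smooth_iff] at hw ⊢
  refine ⟨fun a b c d hab hbc hcd h1 h2 h3 => ?_, fun a b c d hab hbc hcd h1 h2 h3 => ?_⟩
  · apply hw.1 (p.succAbove a) (p.succAbove b) (p.succAbove c) (p.succAbove d) <;> simpa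
  · apply hw.2 (p.succAbove a) (p.succAbove b) (p.succAbove c) (p.succAbove d) <;> simpa

/-- A smooth permutation decreases from the position of its largest value on, or its inverse
does. -/
theorem strictAntiOn_or_of_mem_smooth {n : ℕ} {w : Equiv.Perm (Fin (n + 1))}
    (hw : w ∈ smooth (n + 1)) :
    StrictAntiOn w (Set.Ici (w⁻¹ (Fin.last n))) ∨
      StrictAntiOn ⇑(w⁻¹) (Set.Ici (w (Fin.last n))) := by
  rw [mem_smooth_iff] at hw
  obtain ⟨h3412, h4231⟩ := hw
  set d := w⁻¹ (Fin.last n) with hd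
  have hwd : w d = Fin.last n := by simp [hd]
  have hlt : ∀ {a}, a ≠ d → w a < w d := fun {a} ha => by
    rw [hwd, Fin.lt_last_iff_ne_last, ← hwd]
    exact fun e => ha (w.injective e)
  -- An ascent to the right of the largest value takes place below the last value.
  have asc : ∀ {a b}, d ≤ a → a < b → w a < w b → w a < w (Fin.last n) ∧ d < a := by
    intro a b hda hab hw'
    have hne : a ≠ d := by
      rintro rfl
      exact (hlt hab.ne').not_gt hw'
    have hda' := lt_of_le_of_ne hda hne.symm
    refine ⟨?_, hda'⟩
    by_contra! hle
    have hal : a ≠ Fin.last n := (hab.trans_le (Fin.le_last b)).ne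
    have hlta : w (Fin.last n) < w a :=
      lt_of_le_of_ne hle fun e => hal (w.injective e).symm
    have hb : b < Fin.last n := by
      rw [Fin.lt_last_iff_ne_last]
      rintro rfl
      exact lt_asymm hw' hlta
    exact h4231 d a b (Fin.last n) hda' hab hb hlta hw' (hlt (hda'.trans hab).ne')
  by_contra! hno
  simp only [StrictAntiOn, not_forall, not_lt] at hno
  obtain ⟨⟨a, hda, b, -, hab, hab'⟩, ⟨x, hx, y, hy, hxy, hxy'⟩⟩ := hno
  obtain ⟨p, rfl⟩ := w.surjective x
  obtain ⟨q, rfl⟩ := w.surjective y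
  simp only [Equiv.Perm.inv_def, Equiv.symm_apply_apply] at hxy'
  have hpq : p < q := lt_of_le_of_ne hxy' fun e => hxy.ne (by rw [e])
  have hab2 : w a < w b := lt_of_le_of_ne hab' fun e => hab.ne (w.injective e)
  obtain ⟨h1, h2⟩ := asc hda hab hab2
  have hpl : p < Fin.last n := hpq.trans_le (Fin.le_last q)
  have hep : w (Fin.last n) < w p :=
    lt_of_le_of_ne hx fun e => hpl.ne (w.injective e).symm
  have hpd : p < d := by
    by_contra! hle
    exact (asc hle hpq hxy).1.not_gt hep
  exact h3412 p d a (Fin.last n) hpd h2 (hab.trans_le (Fin.le_last b)) h1 hep (hlt hpd.ne)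

/-! ### The exponents of a smooth permutation -/

/-- A multiset of natural numbers is down-closed if it contains all numbers below each of its
members. Multiplicities are not restricted. -/
def DownClosed (M : Multiset ℕ) : Prop :=
  ∀ k ∈ M, ∀ j ≤ k, j ∈ M

/-- `M` is a multiset of exponents of `w`: `h w` is the product of the `q`-analogues of the
numbers `e + 1`, for `e ∈ M`. The last condition, which links the exponents with the decreasing
runs at the end of `w` and of `w⁻¹`, is what makes the induction work. -/
def HasExponents {n : ℕ} (w : Equiv.Perm (Fin n)) (M : Multiset ℕ) : Prop :=
  M.card = n ∧ DownClosed M ∧ h w = (M.map qInt).prod ∧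
    ∀ k < n, StrictAntiOn w {a | n ≤ a + k + 1} ∨ StrictAntiOn ⇑(w⁻¹) {a | n ≤ a + k + 1} → k ∈ M

lemma HasExponents.of_inv {n : ℕ} {w : Equiv.Perm (Fin n)} {M : Multiset ℕ}
    (hM : HasExponents w⁻¹ M) : HasExponents w M := by
  obtain ⟨h1, h2, h3, h4⟩ := hM
  refine ⟨h1, h2, by rw [← h3, h_inv], fun k hk hor => h4 k hk ?_⟩
  rw [inv_inv]
  exact hor.symm

lemma le_of_strictAntiOn_ins {n : ℕ} {d : Fin (n + 1)} {w : Equiv.Perm (Fin n)} {k : ℕ}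
    (hk : k < n + 1) (ha : StrictAntiOn (ins d w) {a | n + 1 ≤ a + k + 1}) : k ≤ n - d := by
  by_contra! hlt
  have hd := d.2
  have := ha (a := ⟨n - k, by omega⟩) (b := d) (by simp; omega) (by simp; omega)
    (Fin.lt_def.2 (by simp; omega))
  rw [ins_self] at this
  exact this.not_ge (Fin.le_last _)

lemma le_of_strictAntiOn_inv_ins {n : ℕ} {d : Fin (n + 1)} {w : Equiv.Perm (Fin n)} {k : ℕ}
    (hk : k < n + 1) (ha : StrictAntiOn ⇑((ins d w)⁻¹) {a | n + 1 ≤ a + k + 1}) : k ≤ n - d := by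
  -- The positions of the `k + 1` largest values decrease down to `d`.
  have key : ∀ (i : ℕ) (hi : i ≤ k), d + i ≤ ((ins d w)⁻¹ ⟨n - i, by omega⟩ : ℕ) := by
    intro i
    induction i with
    | zero =>
      intro _
      have : (ins d w)⁻¹ (Fin.last n) = d := by rw [Equiv.Perm.inv_eq_iff_eq, ins_self]
      exact (congrArg Fin.val this).ge
    | succ i ih =>
      intro hi
      have h1 := ih (by omega)
      have h2 := ha (a := ⟨n - (i + 1), by omega⟩) (b := ⟨n - i, by omega⟩) (by simp; omega)
        (by simp; omega) (Fin.lt_def.2 (by simp; omega))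
      rw [Fin.lt_def] at h2
      omega
  have h1 := key k le_rfl
  have h2 := ((ins d w)⁻¹ ⟨n - k, by omega⟩).2
  omega

lemma HasExponents.ins {n : ℕ} {d : Fin (n + 1)} {w : Equiv.Perm (Fin n)} {M : Multiset ℕ}
    (hw : StrictAntiOn (ins d w) (Set.Ici d)) (hM : HasExponents w M) :
    HasExponents (ins d w) ((n - d) ::ₘ M) := by
  obtain ⟨h1, h2, h3, h4⟩ := hM
  have hlow : ∀ j ≤ n - (d : ℕ), j ∈ (n - (d : ℕ)) ::ₘ M := by
    intro j hj
    rw [Multiset.mem_cons]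
    rcases hj.eq_or_lt with rfl | hj
    · exact Or.inl rfl
    · refine Or.inr (h2 (n - d - 1) (h4 _ (by omega) (Or.inl ?_)) j (by omega))
      intro a ha b _ hab
      rw [Set.mem_ofPred_eq] at ha
      exact strictAntiOn_of_ins hw (by omega) hab
  refine ⟨by simp [h1], fun k hk j hj => ?_, by rw [h_ins hw, h3]; simp, fun k hk hor => ?_⟩
  · rcases Multiset.mem_cons.1 hk with rfl | hk
    · exact hlow j hj
    · exact Multiset.mem_cons_of_mem (h2 k hk j hj)
  · exact hlow k (hor.elim (le_of_strictAntiOn_ins hk) (le_of_strictAntiOn_inv_ins hk))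

theorem exists_hasExponents {n : ℕ} {w : Equiv.Perm (Fin n)} (hw : w ∈ smooth n) :
    ∃ M, HasExponents w M := by
  induction n with
  | zero =>
    refine ⟨0, rfl, by simp [DownClosed], ?_, by simp⟩
    classical
    rw [h_eq, Fintype.sum_subsingleton _ w, if_pos (RankLE.refl _)]
    simp [numInv]
  | succ n ih =>
    have key : ∀ u ∈ smooth (n + 1), StrictAntiOn u (Set.Ici (u⁻¹ (Fin.last n))) →
        ∃ M, HasExponents u M := by
      intro u hu hanti
      obtain ⟨d, v, rfl⟩ := exists_eq_ins u
      obtain ⟨M, hM⟩ := ih (mem_smooth_of_ins hu)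
      have : (ins d v)⁻¹ (Fin.last n) = d := by rw [Equiv.Perm.inv_eq_iff_eq, ins_self]
      rw [this] at hanti
      exact ⟨_, hM.ins hanti⟩
    rcases strictAntiOn_or_of_mem_smooth hw with hanti | hanti
    · exact key w hw hanti
    · obtain ⟨M, hM⟩ := key w⁻¹ (inv_mem_smooth hw) (by rwa [inv_inv])
      exact ⟨M, hM.of_inv⟩

/-! ### Products of `q`-analogues coded by lists of booleans -/

/-- The product of the `q`-analogues of `c + 1`, where `c` runs over the numbers of entries `true`
in the nonempty final segments of a list. Together with one further zero, which contributes the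
factor `1`, these numbers form a down-closed multiset, and every nonempty one arises so. -/
noncomputable def codePoly : List Bool → ℤ[X]
  | [] => 1
  | b :: l => qInt ((b :: l).count true) * codePoly l

lemma exists_codePoly_eq {n : ℕ} {M : Multiset ℕ} (hc : M.card = n + 1) (hM : DownClosed M) :
    ∃ l : List Bool, l.length = n ∧ (M.map qInt).prod = codePoly l ∧ l.count true ∈ M ∧
      ∀ k ∈ M, k ≤ l.count true := by
  induction n generalizing M with
  | zero =>
    obtain ⟨a, rfl⟩ := Multiset.card_eq_one.1 hc
    have h0 := hM a (by simp) 0 (Nat.zero_le _)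
    rw [Multiset.mem_singleton] at h0
    subst h0
    exact ⟨[], by simp [codePoly, qInt]⟩
  | succ n ih =>
    have hne : M.toFinset.Nonempty := by
      rw [Multiset.toFinset_nonempty]
      rintro rfl
      simp at hc
    obtain ⟨m, hm, hmax⟩ := Finset.exists_max_image M.toFinset id hne
    simp only [Multiset.mem_toFinset, id] at hm hmax
    have hcons := Multiset.cons_erase hm
    have herase : ∀ {j}, j ∈ M → j ≠ m → j ∈ M.erase m := fun hj hjm =>
      (Multiset.mem_erase_of_ne hjm).2 hj
    have hM' : DownClosed (M.erase m) := by
      intro k hk j hj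
      have hkM := Multiset.mem_of_mem_erase hk
      by_cases hjm : j = m
      · have := hmax k hkM
        rwa [show j = k by omega]
      · exact herase (hM k hkM j hj) hjm
    obtain ⟨l, hl, hprod, hmem, hle⟩ := ih (M := M.erase m)
      (by rw [Multiset.card_erase_of_mem hm, hc]; rfl) hM'
    have hcm := hmax _ (Multiset.mem_of_mem_erase hmem)
    obtain ⟨b, hb⟩ : ∃ b : Bool, (b :: l).count true = m := by
      rcases hcm.eq_or_lt with heq | hlt
      · exact ⟨false, by simp [heq]⟩
      · have := hle (m - 1) (herase (hM m hm _ (by omega)) (by omega))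
        exact ⟨true, by simp; omega⟩
    refine ⟨b :: l, by simp [hl], ?_, hb ▸ hm, hb ▸ hmax⟩
    rw [← hcons, Multiset.map_cons, Multiset.prod_cons, hprod, codePoly, hb]

lemma qInt_ne_zero (m : ℕ) : qInt m ≠ 0 := by
  intro h0
  have := congrArg (eval 1) h0
  simp [qInt, eval_finsetSum] at this
  norm_cast at this

lemma aeval_qInt_mul {ζ : ℂ} (m : ℕ) : aeval ζ (qInt m) * (ζ - 1) = ζ ^ (m + 1) - 1 := by
  rw [← geom_sum_mul, qInt]
  simp

lemma exists_le_of_aeval_codePoly_eq_zero {ζ : ℂ} {l : List Bool}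
    (h0 : aeval ζ (codePoly l) = 0) : ∃ m ≤ l.count true, aeval ζ (qInt m) = 0 := by
  induction l with
  | nil => simp [codePoly] at h0
  | cons b l ih =>
    rw [codePoly, map_mul, mul_eq_zero] at h0
    rcases h0 with h0 | h0
    · exact ⟨_, le_rfl, h0⟩
    · obtain ⟨m, hm, h0⟩ := ih h0
      exact ⟨m, hm.trans ((List.sublist_cons_self b l).count_le true), h0⟩

/-- The largest exponent `c` is read off from the product, as the largest number such that the
primitive roots of unity of order `c + 1` are zeros of the product. -/
lemma count_le_of_codePoly_eq {l l' : List Bool} (heq : codePoly l = codePoly l') :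
    l.count true ≤ l'.count true := by
  rcases Nat.eq_zero_or_pos (l.count true) with h0 | hpos
  · omega
  obtain ⟨b, t, rfl⟩ : ∃ b t, l = b :: t := by
    cases l with
    | nil => simp at hpos
    | cons b t => exact ⟨b, t, rfl⟩
  set c := (b :: t).count true with hc
  have hζ := Complex.isPrimitiveRoot_exp (c + 1) (by omega)
  set ζ := Complex.exp (2 * Real.pi * Complex.I / ((c + 1 : ℕ) : ℂ))
  have hne : ζ - 1 ≠ 0 := sub_ne_zero.2 (hζ.ne_one (by omega))
  have hz : aeval ζ (codePoly l') = 0 := by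
    rw [← heq, codePoly, map_mul, ← hc]
    have : aeval ζ (qInt c) * (ζ - 1) = 0 := by rw [aeval_qInt_mul, hζ.pow_eq_one, sub_self]
    rw [(mul_eq_zero.1 this).resolve_right hne, zero_mul]
  obtain ⟨m, hm, hm0⟩ := exists_le_of_aeval_codePoly_eq_zero hz
  have hpow : ζ ^ (m + 1) = 1 := by
    rw [← sub_eq_zero, ← aeval_qInt_mul, hm0, zero_mul]
  have := Nat.le_of_dvd (Nat.succ_pos m) (hζ.dvd_of_pow_eq_one _ hpow)
  omega

lemma codePoly_injOn (n : ℕ) : Set.InjOn codePoly {l | l.length = n} := by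
  intro l hl l' hl' heq
  rw [Set.mem_ofPred_eq] at hl hl'
  induction n generalizing l l' with
  | zero => rw [List.length_eq_zero_iff.1 hl, List.length_eq_zero_iff.1 hl']
  | succ n ih =>
    have hcount := le_antisymm (count_le_of_codePoly_eq heq) (count_le_of_codePoly_eq heq.symm)
    obtain ⟨b, t, rfl⟩ := List.exists_cons_of_length_eq_add_one hl
    obtain ⟨b', t', rfl⟩ := List.exists_cons_of_length_eq_add_one hl'
    rw [codePoly, codePoly, hcount] at heq
    obtain rfl := ih (by simpa using hl) (by simpa using hl')
      (mul_left_cancel₀ (qInt_ne_zero _) heq)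
    have : b = b' := by
      cases b <;> cases b' <;> simp at hcount ⊢
    rw [this]

lemma ncard_image_codePoly (n : ℕ) : (codePoly '' {l | l.length = n}).ncard = 2 ^ n := by
  rw [(codePoly_injOn n).ncard_image]
  change Nat.card (List.Vector Bool n) = 2 ^ n
  rw [Nat.card_eq_fintype_card, card_vector, Fintype.card_bool]

/-! ### Unimodal permutations -/

lemma mem_smooth_of_mem_unimodal {n : ℕ} {w : Equiv.Perm (Fin n)} (hw : w ∈ unimodal n) :
    w ∈ smooth n := by
  obtain ⟨i, -, hi⟩ := hw
  have inc : ∀ (k a : ℕ) (hk : a + (k + 1) < n), a + (k + 1) < i →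
      w ⟨a, by omega⟩ < w ⟨a + (k + 1), hk⟩ := by
    intro k a
    induction k with
    | zero => exact fun hk hki => (hi a hk).1 hki
    | succ k ih =>
      exact fun hk hki =>
        (ih (by omega) (by omega)).trans ((hi (a + (k + 1)) hk).1 (by omega))
  have dec : ∀ (k a : ℕ) (hk : a + (k + 1) < n), i ≤ a →
      w ⟨a + (k + 1), hk⟩ < w ⟨a, by omega⟩ := by
    intro k a
    induction k with
    | zero => exact fun hk hki => (hi a hk).2 (by omega)
    | succ k ih =>
      exact fun hk hki => ((hi (a + (k + 1)) hk).2 (by omega)).trans (ih (by omega) hki)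
  have valley : ∀ a b c, a < b → b < c → w b < w a → ¬ w b < w c := by
    intro a b c hab hbc h1 h2
    rcases lt_or_ge (b : ℕ) i with hb | hb
    · have := inc (b - a - 1) a (by omega) (by omega)
      rw [show (⟨a + (b - a - 1 + 1), by omega⟩ : Fin n) = b from Fin.ext (by simp; omega)] at this
      exact this.not_gt h1
    · have := dec (c - b - 1) b (by omega) hb
      rw [show (⟨b + (c - b - 1 + 1), by omega⟩ : Fin n) = c from Fin.ext (by simp; omega)] at this
      exact this.not_gt h2
  rw [mem_smooth_iff]
  refine ⟨fun a b c d hab hbc hcd h1 h2 h3 => ?_, fun a b c d hab hbc hcd h1 h2 h3 => ?_⟩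
  · exact valley b c d hbc hcd ((h1.trans h2).trans h3) h1
  · exact valley a b c hab hbc (h2.trans h3) h2

lemma strictMonoOn_ins {n : ℕ} {p : Fin (n + 1)} {u : Equiv.Perm (Fin n)}
    (hu : ∀ a b : Fin n, a < b → (b : ℕ) < p → u a < u b) : StrictMonoOn (ins p u) (Set.Iic p) := by
  intro x _ y hy hxy
  rcases (Set.mem_Iic.1 hy).eq_or_lt with rfl | hy
  · rw [ins_self, Fin.lt_last_iff_ne_last, ← ins_self y u]
    exact fun e => hxy.ne ((ins y u).injective e)
  · obtain ⟨a, rfl⟩ := Fin.exists_succAbove_eq (hxy.trans hy).ne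
    obtain ⟨b, rfl⟩ := Fin.exists_succAbove_eq hy.ne
    rw [Fin.succAbove_lt_succAbove_iff] at hxy
    rw [ins_succAbove, ins_succAbove, Fin.castSucc_lt_castSucc_iff]
    exact hu a b hxy (Fin.lt_def.1 ((Fin.succAbove_lt_iff_castSucc_lt _ _).1 hy))

lemma strictAntiOn_ins {n : ℕ} {p : Fin (n + 1)} {u : Equiv.Perm (Fin n)}
    (hu : ∀ a b : Fin n, a < b → (p : ℕ) ≤ a → u b < u a) : StrictAntiOn (ins p u) (Set.Ici p) := by
  intro x hx y _ hxy
  rcases (Set.mem_Ici.1 hx).eq_or_lt with rfl | hx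
  · rw [ins_self, Fin.lt_last_iff_ne_last, ← ins_self p u]
    exact fun e => hxy.ne' ((ins p u).injective e)
  · obtain ⟨a, rfl⟩ := Fin.exists_succAbove_eq hx.ne'
    obtain ⟨b, rfl⟩ := Fin.exists_succAbove_eq (hx.trans hxy).ne'
    rw [Fin.succAbove_lt_succAbove_iff] at hxy
    rw [ins_succAbove, ins_succAbove, Fin.castSucc_lt_castSucc_iff]
    exact hu a b hxy (Fin.le_def.1 ((Fin.lt_succAbove_iff_le_castSucc _ _).1 hx))

/-- If a new largest value is inserted in a unimodal permutation just before or just after the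
previous largest one, the result is unimodal, and the new exponent is one more than the largest of
the previous ones, or equal to it, respectively. -/
theorem exists_unimodal_h_eq (l : List Bool) :
    ∃ (d : Fin (l.length + 1)) (u : Equiv.Perm (Fin (l.length + 1))),
      d + l.count true = l.length ∧ StrictMonoOn u (Set.Iic d) ∧ StrictAntiOn u (Set.Ici d) ∧
        h u = codePoly l := by
  induction l with
  | nil =>
    have : Subsingleton (Fin (([] : List Bool).length + 1)) :=
      inferInstanceAs (Subsingleton (Fin 1))
    refine ⟨0, 1, rfl, Set.subsingleton_of_subsingleton.strictMonoOn _,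
      Set.subsingleton_of_subsingleton.strictAntiOn _, ?_⟩
    classical
    rw [h_eq, Fintype.sum_subsingleton _ 1, if_pos (RankLE.refl _), numInv_one, pow_zero, codePoly]
  | cons b l ih =>
    obtain ⟨d, u, hd, hmono, hanti, hu⟩ := ih
    obtain ⟨p, hp, hdp, hpd⟩ : ∃ p : Fin (l.length + 1 + 1),
        p + (b :: l).count true = l.length + 1 ∧ (d : ℕ) ≤ p ∧ (p : ℕ) ≤ d + 1 := by
      cases b
      · exact ⟨d.succ, by simp; omega, by simp, by simp⟩
      · exact ⟨d.castSucc, by simp; omega, by simp, by simp⟩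
    have hanti' : StrictAntiOn (ins p u) (Set.Ici p) := strictAntiOn_ins fun x y hxy hx =>
      hanti (Fin.le_def.2 (by omega)) (Fin.le_def.2 (by omega)) hxy
    refine ⟨p, ins p u, hp, strictMonoOn_ins fun x y hxy hy => ?_, hanti', ?_⟩
    · exact hmono (Fin.le_def.2 (by omega)) (Fin.le_def.2 (by omega)) hxy
    · rw [h_ins hanti', hu, codePoly, show l.length + 1 - (p : ℕ) = (b :: l).count true by omega]

lemma mem_unimodal {n : ℕ} {d : Fin n} {u : Equiv.Perm (Fin n)}
    (hmono : StrictMonoOn u (Set.Iic d)) (hanti : StrictAntiOn u (Set.Ici d)) :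
    u ∈ unimodal n := by
  refine ⟨d + 1, d.2, fun j hj => ⟨fun hjd => ?_, fun hjd => ?_⟩⟩
  · exact hmono (Fin.le_def.2 (by simp; omega)) (Fin.le_def.2 (by simp; omega))
      (Fin.lt_def.2 (by simp))
  · exact hanti (Fin.le_def.2 (by simp; omega)) (Fin.le_def.2 (by simp; omega))
      (Fin.lt_def.2 (by simp))

lemma image_h_smooth_subset (n : ℕ) :
    h '' smooth (n + 1) ⊆ codePoly '' {l | l.length = n} := by
  rintro _ ⟨w, hw, rfl⟩
  obtain ⟨M, hc, hM, hprod, -⟩ := exists_hasExponents hw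
  obtain ⟨l, hl, hl', -⟩ := exists_codePoly_eq hc hM
  exact ⟨l, hl, by rw [hprod, hl']⟩

lemma image_codePoly_subset (n : ℕ) :
    codePoly '' {l | l.length = n} ⊆ h '' unimodal (n + 1) := by
  rintro _ ⟨l, rfl, rfl⟩
  obtain ⟨d, u, -, hmono, hanti, hu⟩ := exists_unimodal_h_eq l
  exact ⟨u, mem_unimodal hmono hanti, hu⟩

end SmoothBruhat

theorem mainTheorem1 (n : ℕ) (hn : 1 ≤ n) :
    SmoothBruhat.h '' SmoothBruhat.smooth n = SmoothBruhat.h '' SmoothBruhat.unimodal n ∧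
      (SmoothBruhat.h '' SmoothBruhat.smooth n).ncard = 2 ^ (n - 1) := by
  obtain ⟨n, rfl⟩ := Nat.exists_eq_add_of_le' hn
  have h1 := SmoothBruhat.image_h_smooth_subset n
  have h2 := SmoothBruhat.image_codePoly_subset n
  have h3 : SmoothBruhat.h '' SmoothBruhat.unimodal (n + 1) ⊆
      SmoothBruhat.h '' SmoothBruhat.smooth (n + 1) :=
    Set.image_mono fun _ => SmoothBruhat.mem_smooth_of_mem_unimodal
  refine ⟨(h1.trans h2).antisymm h3, ?_⟩
  rw [h1.antisymm (h2.trans h3), SmoothBruhat.ncard_image_codePoly, Nat.add_sub_cancel]
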